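/- **Theorem.** Let $\Lambda$ be an artin algebra (an algebra that is finitely generated as a module over a commutative artinian ring), let $\mathcal C=\mathrm{mod}\,\Lambda$ be the category of finitely generated left $\Lambda$-modules, and let $\mathrm{mod}(\mathcal C)$ be the category of finitely presented contravariant functors from $\mathcal C$ to abelian groups. Let $\mathrm{maps}(\mathcal C)$ be the category whose objects are the morphisms $f:T_0\to T_1$ of $\mathcal C$ and whose morphisms are commutative squares. Two morphisms $(h_0,h_1),(h_0',h_1')$ from $f$ to $g$ are homotopic if $h_1-h_1'$ factors through $g$. Let $\Phi:\mathrm{maps}(\mathcal C)\to\mathrm{mod}(\mathcal C)$ be $\Phi(f)=\mathrm{Coker}((-,T_0)\xrightarrow{(-,f)}(-,T_1))$. Subcategories are full and closed under isomorphisms; $\Phi(\mathcal T)$ denotes the closure under isomorphisms of the image of $\mathcal T$. A short exact sequence $0\to N\to E\to M\to 0$ in $\mathrm{maps}(\mathcal C)$ is *$F$-exact* (relative exact) if both columns split and the induced column $0\to\mathrm{Ker}\,N\to\mathrm{Ker}\,E\to\mathrm{Ker}\,M\to 0$ of kernels is split exact. $F$-projective objects, $F$-projective resolutions, relative projective dimension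 and $\mathrm{Ext}^k_F$ are taken with respect to these sequences; $\mathrm{Ext}^1_F(M,N)=0$ means that every $F$-exact sequence $0\to N\to E\to M\to 0$ splits. A subcategory $\mathcal T$ of $\mathrm{maps}(\mathcal C)$ is *relative tilting* if each of its objects has finite relative projective dimension, $\mathrm{Ext}^k_F(M,N)=0$ for all $M,N\in\mathcal T$ and $k\ge1$, and for each $C\in\mathcal C$ the object $0\to C$ has a finite $F$-exact coresolution by objects of $\mathcal T$. A subcategory $\mathscr T$ of $\mathrm{mod}(\mathcal C)$ is *classical tilting* if each of its objects has projective dimension at most $1$, $\mathrm{Ext}^1(G,H)=0$ for all $G,H\in\mathscr T$, and for each $C\in\mathcal C$ there is an exact sequence $0\to(-,C)\to G_0\to G_1\to0$ with $G_0,G_1\in\mathscr T$. Consider the following conditions on a subcategory $\mathcal T$ of $\mathrm{maps}(\mathcal C)$: (i) the objects $f:T_0\to T_1$ of $\mathcal T$ are monomorphisms; (ii) $\mathrm{Ext}^1_F(f,g)=0$ for all $f,g\in\mathcal T$; (iii) for each $C\in\mathcal C$ there are $f:T_0\to T_1$ and $g:T_0\to T_1'$ in $\mathcal T$ and an $F$-exact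 sequence $0\to(0\to C)\to f\to g\to0$ whose first column is $0\to0\to T_0\xrightarrow{1}T_0\to0$ and whose second column $0\to C\to T_1\to T_1'\to0$ splits. Call $\mathcal T$ *homotopy closed* if, with each $f\in\mathcal T$, it contains every monomorphism $g$ that is isomorphic to $f$ in the category of maps modulo homotopy. For a subcategory $\mathscr T$ of $\mathrm{mod}(\mathcal C)$ let $\Psi(\mathscr T)$ consist of the maps $f:T_0\to T_1$ for which there is an exact sequence $0\to(-,T_0)\xrightarrow{(-,f)}(-,T_1)\to G\to0$ with $G\in\mathscr T$. Then: 1. $\mathcal T\mapsto\Phi(\mathcal T)$ and $\mathscr T\mapsto\Psi(\mathscr T)$ are mutually inverse bijections between the homotopy closed relative tilting subcategories $\mathcal T$ of $\mathrm{maps}(\mathcal C)$ satisfying (i), (ii), (iii) and the classical tilting subcategories $\mathscr T$ of $\mathrm{mod}(\mathcal C)$. 2. If $\mathcal T$ is any subcategory of $\mathrm{maps}(\mathcal C)$ satisfying (i), (ii), (iii), then $\mathcal T$ is relative tilting, $\Phi(\mathcal T)$ is classical tilting, and $\Psi(\Phi(\mathcal T))$ consists of the monomorphisms that are homotopy equivalent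 to an object of $\mathcal T$. 3. A homotopy closed class $\mathcal T$ of monomorphisms is relative tilting and satisfies (i), (ii), (iii) if and only if $\Phi(\mathcal T)$ is classical tilting. -/

import Mathlib

open CategoryTheory CategoryTheory.Limits

universe v u w

namespace MapsTilting

/-- An artin algebra (a finite algebra over a commutative artinian ring) is left noetherian. -/
theorem isNoetherianRing_of_artinAlgebra (R : Type w) (A : Type u) [CommRing R] [IsArtinianRing R]
    [Ring A] [Algebra R A] [Module.Finite R A] : IsNoetherianRing A :=
  isNoetherian_of_tower R (inferInstanceAs (IsNoetherian R A))

noncomputable section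

variable {C : Type u} [Category.{v} C] [Preadditive C]

/-! ### Finitely presented functors -/

variable (C) in
/-- A contravariant functor `M` from `C` to abelian groups is finitely presented if there is an
exact sequence `(-, X₁) ⟶ (-, X₀) ⟶ M ⟶ 0`. Such a functor is automatically additive. -/
def isFinitelyPresented : ObjectProperty (Cᵒᵖ ⥤ AddCommGrpCat.{v}) := fun M =>
  ∃ (X₁ X₀ : C) (f : X₁ ⟶ X₀) (π : preadditiveYoneda.obj X₀ ⟶ M)
    (zero : preadditiveYoneda.map f ≫ π = 0),
      (ShortComplex.mk (preadditiveYoneda.map f) π zero).Exact ∧ Epi π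

variable (C) in
/-- The category `mod(C)` of finitely presented contravariant functors from `C` to abelian groups,
a full subcategory of the category of all functors. -/
abbrev ModFP := (isFinitelyPresented C).FullSubcategory

theorem isFinitelyPresented_cokernel {X₁ X₀ : C} (f : X₁ ⟶ X₀) :
    isFinitelyPresented C (cokernel (preadditiveYoneda.map f)) :=
  ⟨X₁, X₀, f, cokernel.π _, cokernel.condition _, ShortComplex.exact_cokernel _, inferInstance⟩

theorem isFinitelyPresented_representable (X : C) :
    isFinitelyPresented C (preadditiveYoneda.obj X) := by
  refine ⟨X, X, 0, 𝟙 _, by simp, ?_, inferInstance⟩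
  rw [ShortComplex.exact_iff_mono]
  · dsimp
    infer_instance
  · simp

variable (C) in
/-- The Yoneda embedding `X ↦ (-, X)` of `C` into `mod(C)`. -/
def representable : C ⥤ ModFP C :=
  (isFinitelyPresented C).lift preadditiveYoneda isFinitelyPresented_representable

variable (C) in
/-- The functor `Φ : maps(C) ⥤ mod(C)`, sending `f : X₁ ⟶ X₀` to
`Coker ((-, f) : (-, X₁) ⟶ (-, X₀))`. The category `maps(C)` is Mathlib's `Arrow C`. -/
def Phi : Arrow C ⥤ ModFP C :=
  (isFinitelyPresented C).lift (preadditiveYoneda.mapArrow ⋙ coker _)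
    (fun f => isFinitelyPresented_cokernel f.hom)

/-- `0 ⟶ G ⟶ H ⟶ F ⟶ 0` is an exact sequence of finitely presented functors. -/
def ModShortExact {G H F : ModFP C} (a : G ⟶ H) (b : H ⟶ F) : Prop :=
  ∃ zero : a.hom ≫ b.hom = 0, (ShortComplex.mk a.hom b.hom zero).ShortExact

/-- Classical tilting subcategories of `mod(C)`; the full subcategory is given by the class `T` of
its objects. -/
structure IsClassicalTilting (T : ObjectProperty (ModFP C)) : Prop where
  /-- full subcategories are understood to be closed under isomorphisms -/
  isoClosed : T.IsClosedUnderIsomorphisms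
  /-- every object has projective dimension at most one -/
  pdim_le_one : ∀ F, T F → ∃ (P₁ P₀ : ModFP C) (a : P₁ ⟶ P₀) (b : P₀ ⟶ F),
    Projective P₁ ∧ Projective P₀ ∧ ModShortExact a b
  /-- `Ext¹(F, G) = 0`: every extension of `F` by `G` in `mod(C)` splits -/
  ext_eq_zero : ∀ F G, T F → T G → ∀ (H : ModFP C) (a : G ⟶ H) (b : H ⟶ F),
    ModShortExact a b → IsSplitEpi b
  /-- there is an exact sequence `0 ⟶ (-, X) ⟶ T₀ ⟶ T₁ ⟶ 0` -/
  coresolution : ∀ X : C, ∃ (T₀ T₁ : ModFP C) (a : (representable C).obj X ⟶ T₀) (b : T₀ ⟶ T₁),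
    T T₀ ∧ T T₁ ∧ ModShortExact a b

/-- `f` and `g` are isomorphic in the category of maps modulo homotopy (two maps `h`, `h'` from
`f` to `g` being homotopic if `h.right - h'.right` factors through `g`). -/
def HomotopyEquivalent (f g : Arrow C) : Prop :=
  Nonempty ((Preadditive.RightFreyd.quotient C).obj f ≅ (Preadditive.RightFreyd.quotient C).obj g)

/-- With each `f` in `T`, every monomorphism that is homotopy equivalent to `f` is in `T`. -/
def HomotopyClosed (T : ObjectProperty (Arrow C)) : Prop :=
  ∀ f g : Arrow C, T f → Mono g.hom → HomotopyEquivalent f g → T g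

/-- The subcategory of `maps(C)` which corresponds under `Ψ` to a subcategory `T` of `mod(C)` of
projective dimension at most one. The functor `Ψ` sends a projective resolution
`⋯ ⟶ (-, X₁) ⟶ (-, X₀) ⟶ 0` to the map `X₁ ⟶ X₀`, and it is applied here to the projective
resolutions `0 ⟶ (-, X₁) ⟶ (-, X₀) ⟶ 0` of the objects of `T`. -/
def Psi (T : ObjectProperty (ModFP C)) : ObjectProperty (Arrow C) := fun f =>
  ∃ (F : ModFP C) (π : (representable C).obj f.right ⟶ F), T F ∧ ModShortExact ((representable C).map f.hom) π

/-! ### The exact structure on the category of maps -/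

/-- `X ⟶ Y ⟶ Z` is (the nontrivial part of) a split short exact sequence in `C`. -/
def SplitShort {X Y Z : C} (a : X ⟶ Y) (b : Y ⟶ Z) : Prop :=
  ∃ zero : a ≫ b = 0, Nonempty (ShortComplex.mk a b zero).Splitting

variable [HasKernels C]

/-- Relative exact (`F`-exact) sequences `0 ⟶ N ⟶ E ⟶ M ⟶ 0` of maps: both columns split, and so
does the induced column of kernels. -/
def FExact {N E M : Arrow C} (i : N ⟶ E) (p : E ⟶ M) : Prop :=
  SplitShort ((ker C).map i) ((ker C).map p) ∧ SplitShort i.left p.left ∧ SplitShort i.right p.right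

/-- `Ext¹_F(M, N) = 0`: every `F`-exact sequence `0 ⟶ N ⟶ E ⟶ M ⟶ 0` splits. -/
def FExtOneVanishes (M N : Arrow C) : Prop :=
  ∀ (E : Arrow C) (i : N ⟶ E) (p : E ⟶ M), FExact i p → IsSplitEpi p

/-- `P` is `F`-projective: `Hom(P, -)` is exact on `F`-exact sequences. -/
def FProjective (P : Arrow C) : Prop :=
  ∀ (N E M : Arrow C) (i : N ⟶ E) (p : E ⟶ M), FExact i p →
    ∀ φ : P ⟶ M, ∃ ψ : P ⟶ E, ψ ≫ p = φ

/-- An `F`-exact `F`-projective resolution `⋯ ⟶ P 1 ⟶ P 0 ⟶ M ⟶ 0`, given by its relative syzygies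
`K n` and the `F`-exact sequences `0 ⟶ K (n + 1) ⟶ P n ⟶ K n ⟶ 0`. -/
structure FResolution (M : Arrow C) where
  /-- the `F`-projective terms -/
  P : ℕ → Arrow C
  /-- the relative syzygies -/
  K : ℕ → Arrow C
  /-- the inclusion of a syzygy -/
  incl : ∀ n, K (n + 1) ⟶ P n
  /-- the projection onto a syzygy -/
  proj : ∀ n, P n ⟶ K n
  /-- the zeroth syzygy is the resolved object -/
  zeroth : K 0 ≅ M
  fProjective : ∀ n, FProjective (P n)
  fExact : ∀ n, FExact (incl n) (proj n)

/-- The differential `P (n + 1) ⟶ P n` of an `F`-projective resolution. -/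
def FResolution.d {M : Arrow C} (S : FResolution M) (n : ℕ) : S.P (n + 1) ⟶ S.P n :=
  S.proj (n + 1) ≫ S.incl n

/-- The relative projective dimension of `M` is at most `n`. -/
def FPdimLE (M : Arrow C) (n : ℕ) : Prop :=
  ∃ S : FResolution M, ∀ m, n < m → IsZero (S.P m)

/-- `Ext^(k+1)_F(M, N) = 0`, where `Ext_F` is the right derived functor of `Hom(-, N)`: for every
`F`-projective resolution of `M`, the complex `Hom(P, N)` is exact in degree `k + 1`. -/
def FExtSuccVanishes (k : ℕ) (M N : Arrow C) : Prop :=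
  ∀ (S : FResolution M) (φ : S.P (k + 1) ⟶ N), S.d (k + 1) ≫ φ = 0 →
    ∃ ψ : S.P k ⟶ N, S.d k ≫ ψ = φ

/-- `X` has an `F`-exact coresolution `0 ⟶ X ⟶ T⁰ ⟶ ⋯ ⟶ Tⁿ ⟶ 0` with terms in `T`. -/
inductive FCoresolved (T : ObjectProperty (Arrow C)) : ℕ → Arrow C → Prop
  | base (X T₀ : Arrow C) (e : X ≅ T₀) (h : T T₀) : FCoresolved T 0 X
  | step (n : ℕ) (X T₀ Y : Arrow C) (i : X ⟶ T₀) (p : T₀ ⟶ Y) (h : T T₀) (hex : FExact i p)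
      (hY : FCoresolved T n Y) : FCoresolved T (n + 1) X

/-! ### Relative tilting subcategories -/

variable [HasZeroObject C]

/-- Relative tilting subcategories of `maps(C)`. The object `(0, X, 0)` of `maps(C)`, that is, the
map `0 ⟶ X`, is `(Preadditive.RightFreyd.rightFunctor C).obj X`. -/
structure IsRelativeTilting (T : ObjectProperty (Arrow C)) : Prop where
  isoClosed : T.IsClosedUnderIsomorphisms
  finite_fPdim : ∀ M, T M → ∃ n, FPdimLE M n
  fExt_eq_zero : ∀ M N, T M → T N → ∀ k, FExtSuccVanishes k M N
  coresolution : ∀ X : C, ∃ n, FCoresolved T n ((Preadditive.RightFreyd.rightFunctor C).obj X)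

/-- The three conditions on a subcategory `T` of `maps(C)`. -/
structure ClassicalConditions (T : ObjectProperty (Arrow C)) : Prop where
  /-- the objects are monomorphisms -/
  mono : ∀ f, T f → Mono f.hom
  /-- `Ext¹_F` vanishes between the objects -/
  fExtOne_eq_zero : ∀ f g, T f → T g → FExtOneVanishes f g
  /-- there is a relative exact sequence
  `0 ⟶ (0 ⟶ X) ⟶ (f : T₀ ⟶ T₁) ⟶ (g : T₀ ⟶ T₁') ⟶ 0`, with identity on `T₀` in the first column;
  that the columns, in particular `0 ⟶ X ⟶ T₁ ⟶ T₁' ⟶ 0`, split is part of `FExact` -/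
  coresolution : ∀ X : C, ∃ (T₀ T₁ T₁' : C) (f : T₀ ⟶ T₁) (g : T₀ ⟶ T₁')
    (i : (Preadditive.RightFreyd.rightFunctor C).obj X ⟶ Arrow.mk f)
    (p : Arrow.mk f ⟶ Arrow.mk g),
      T (Arrow.mk f) ∧ T (Arrow.mk g) ∧ p.left = 𝟙 T₀ ∧ FExact i p

end

end MapsTilting

namespace MapsTilting

/-! ### Finitely presented functors, and `Phi` as a functor on maps modulo homotopy. -/

noncomputable section Functors

variable {C : Type u} [Category.{v} C] [Preadditive C]

/-! For monomorphisms `M`, `N`, both Ext groups are controlled by one condition in `C`,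
`CrossVanishing`. An extension of `M` by `N` with split columns is a triangular matrix with
off-diagonal entry `s : M.left ⟶ N.right`, and it splits exactly when `s = a ≫ N.hom + M.hom ≫ b`.
On the functor side, `(-, M.left) ⟶ (-, M.right)` is a projective resolution of `Φ(M)`, so `Ext¹(Φ
M, Φ N)` is the group of the same `s` modulo the same sums. The lemmas are `fExtOneVanishes_iff`,
`isSplitEpi_of_crossVanishing` and `crossVanishing_of_isSplitEpi`. Higher relative Ext vanishes
because a monomorphism has a relative projective resolution of length one.

Coresolutions correspond as well: `Phi` takes relative sequences ending in a monomorphism to short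
exact sequences (`ColumnsSplit.modShortExact`), and the horseshoe construction
`exists_of_modShortExact_phi` goes back.

`Phi` is full and kills exactly the null-homotopic maps, so `Φ(f) ≅ Φ(g)` means homotopy equivalence
(`homotopyEquivalent_iff`); hence `Φ(𝒯)` determines a homotopy closed `𝒯`. Every functor of
projective dimension at most one is hit by a monomorphism because the projectives of `mod(C)` are
representable. -/

theorem exact_of_evaluation {D : Type u} [Category.{v} D] (S : ShortComplex (D ⥤ AddCommGrpCat.{v}))
    (h : ∀ X, (S.map ((evaluation D AddCommGrpCat.{v}).obj X)).Exact) : S.Exact := by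
  rw [ShortComplex.exact_iff_isZero_homology]
  refine Functor.isZero _ fun X => ?_
  exact IsZero.of_iso ((ShortComplex.exact_iff_isZero_homology _).1 (h X))
    (S.mapHomologyIso ((evaluation D AddCommGrpCat.{v}).obj X)).symm

theorem evaluation_exact {D : Type u} [Category.{v} D] {S : ShortComplex (D ⥤ AddCommGrpCat.{v})}
    (h : S.Exact) (X : D) : (S.map ((evaluation D AddCommGrpCat.{v}).obj X)).Exact :=
  h.map _

instance : (representable C).Full :=
  inferInstanceAs ((isFinitelyPresented C).lift preadditiveYoneda _).Full

instance : (representable C).Faithful :=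
  inferInstanceAs ((isFinitelyPresented C).lift preadditiveYoneda _).Faithful

instance : (representable C).Additive where
  map_add := by
    intro X Y f g
    apply ObjectProperty.hom_ext
    ext Z x
    exact Preadditive.comp_add _ _ _ x f g

/-- The element of `F(X)` corresponding to a morphism `(-, X) ⟶ F`. -/
def elt {X : C} {F : ModFP C} (x : (representable C).obj X ⟶ F) : F.obj.obj (Opposite.op X) :=
  x.hom.app (Opposite.op X) (𝟙 X)

theorem elt_comp {X : C} {F G : ModFP C} (x : (representable C).obj X ⟶ F) (a : F ⟶ G) :
    elt (x ≫ a) = a.hom.app _ (elt x) := rfl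

theorem app_eq_map_elt {X Y : C} {F : ModFP C} (x : (representable C).obj X ⟶ F) (y : Y ⟶ X) :
    x.hom.app (Opposite.op Y) y = F.obj.map y.op (elt x) := by
  have h := congrArg (fun (t : (preadditiveYoneda.obj X).obj (Opposite.op X) ⟶ _) => t (𝟙 X))
    (x.hom.naturality y.op)
  refine Eq.trans ?_ h
  change _ = x.hom.app (Opposite.op Y) (y ≫ 𝟙 X)
  rw [Category.comp_id]

theorem elt_injective {X : C} {F : ModFP C} :
    Function.Injective (elt : ((representable C).obj X ⟶ F) → _) := by
  intro x y h
  apply ObjectProperty.hom_ext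
  ext Z z
  exact (app_eq_map_elt x (Y := Z.unop) z).trans
    ((congrArg _ h).trans (app_eq_map_elt y (Y := Z.unop) z).symm)

/-- The ambient functors are not assumed additive, so the Yoneda lemma with additive representables
is not available directly. An element is lifted along the presenting epimorphism instead. -/
theorem elt_surjective {X : C} {F : ModFP C} :
    Function.Surjective (elt : ((representable C).obj X ⟶ F) → _) := by
  intro t
  obtain ⟨X₁, X₀, f, π, zero, -, hπ⟩ := F.property
  have := (NatTrans.epi_iff_epi_app π).1 hπ (Opposite.op X)
  obtain ⟨u, hu⟩ := (AddCommGrpCat.epi_iff_surjective _).1 this t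
  let u' : X ⟶ X₀ := u
  refine ⟨(representable C).map u' ≫ ObjectProperty.homMk π, ?_⟩
  rw [← hu]
  change π.app _ (𝟙 X ≫ u') = _
  rw [Category.id_comp]

/-- Short exactness in `mod(C)` can be tested on morphisms from representable functors. -/
theorem modShortExact_iff {G H F : ModFP C} (a : G ⟶ H) (b : H ⟶ F) :
    ModShortExact a b ↔ a ≫ b = 0 ∧
      (∀ (X : C) (x : (representable C).obj X ⟶ G), x ≫ a = 0 → x = 0) ∧
      (∀ (X : C) (x : (representable C).obj X ⟶ H), x ≫ b = 0 → ∃ y, y ≫ a = x) ∧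
      (∀ (X : C) (x : (representable C).obj X ⟶ F), ∃ y, y ≫ b = x) := by
  constructor
  · rintro ⟨zero, h⟩
    have hm := h.mono_f
    have he := h.epi_g
    rw [NatTrans.mono_iff_mono_app] at hm
    rw [NatTrans.epi_iff_epi_app] at he
    refine ⟨ObjectProperty.hom_ext _ zero, fun X x hx => ?_, fun X x hx => ?_, fun X x => ?_⟩
    · apply elt_injective
      apply (AddCommGrpCat.mono_iff_injective _).1 (hm (Opposite.op X))
      change a.hom.app _ (elt x) = a.hom.app _ (elt (0 : (representable C).obj X ⟶ G))
      rw [← elt_comp, ← elt_comp, hx, zero_comp]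
    · have h' := (ShortComplex.ab_exact_iff _).1 (evaluation_exact h.exact (Opposite.op X)) (elt x)
        (by change b.hom.app _ (elt x) = 0
            rw [← elt_comp, hx]; rfl)
      obtain ⟨y, hy⟩ := h'
      obtain ⟨y, rfl⟩ := elt_surjective y
      exact ⟨y, elt_injective hy⟩
    · obtain ⟨y, hy⟩ := (AddCommGrpCat.epi_iff_surjective _).1 (he (Opposite.op X)) (elt x)
      obtain ⟨y, rfl⟩ := elt_surjective y
      exact ⟨y, elt_injective hy⟩
  · rintro ⟨zero, h₁, h₂, h₃⟩
    refine ⟨congrArg (·.hom) zero, ?_⟩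
    refine @ShortComplex.ShortExact.mk _ _ _ _ ?_ ?_ ?_
    · apply exact_of_evaluation
      intro X
      rw [ShortComplex.ab_exact_iff]
      intro x hx
      obtain ⟨x, rfl⟩ := elt_surjective (X := X.unop) x
      obtain ⟨y, rfl⟩ := h₂ _ x (elt_injective hx)
      exact ⟨elt y, rfl⟩
    · refine (NatTrans.mono_iff_mono_app _).2 fun X => ?_
      rw [AddCommGrpCat.mono_iff_injective]
      intro x y hxy
      obtain ⟨x, rfl⟩ := elt_surjective (X := X.unop) x
      obtain ⟨y, rfl⟩ := elt_surjective (X := X.unop) y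
      have : (x - y) ≫ a = 0 := by
        rw [Preadditive.sub_comp, sub_eq_zero]
        exact elt_injective hxy
      rw [sub_eq_zero.1 (h₁ _ _ this)]
    · refine (NatTrans.epi_iff_epi_app _).2 fun X => ?_
      rw [AddCommGrpCat.epi_iff_surjective]
      intro x
      obtain ⟨x, rfl⟩ := elt_surjective (X := X.unop) x
      obtain ⟨y, rfl⟩ := h₃ _ x
      exact ⟨elt y, rfl⟩

/-- The canonical epimorphism `(-, f.right) ⟶ Φ(f)`. -/
def phiπ (f : Arrow C) : (representable C).obj f.right ⟶ (Phi C).obj f :=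
  ObjectProperty.homMk (cokernel.π (preadditiveYoneda.map f.hom))

theorem map_phiπ (f : Arrow C) : (representable C).map f.hom ≫ phiπ f = 0 :=
  ObjectProperty.hom_ext _ (cokernel.condition (preadditiveYoneda.map f.hom))

theorem phiπ_naturality {f g : Arrow C} (h : f ⟶ g) :
    phiπ f ≫ (Phi C).map h = (representable C).map h.right ≫ phiπ g :=
  ObjectProperty.hom_ext _ (cokernel.π_desc _ _ _)

theorem phiπ_desc {f : Arrow C} {G : ModFP C} (z : (representable C).obj f.right ⟶ G)
    (hz : (representable C).map f.hom ≫ z = 0) : ∃ y, phiπ f ≫ y = z :=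
  ⟨ObjectProperty.homMk (cokernel.desc (preadditiveYoneda.map f.hom) z.hom
    (congrArg (·.hom) hz)), ObjectProperty.hom_ext _ (cokernel.π_desc _ _ _)⟩

instance (f : Arrow C) : Epi (phiπ f) where
  left_cancellation _ _ h := ObjectProperty.hom_ext _
    ((cancel_epi (cokernel.π (preadditiveYoneda.map f.hom))).1 (congrArg (·.hom) h))

theorem exists_lift_phiπ {f : Arrow C} {X : C} (x : (representable C).obj X ⟶ (Phi C).obj f) :
    ∃ u : X ⟶ f.right, (representable C).map u ≫ phiπ f = x := by
  have : Epi (cokernel.π (preadditiveYoneda.map f.hom)) := inferInstance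
  obtain ⟨y, hy⟩ := (AddCommGrpCat.epi_iff_surjective _).1
    ((NatTrans.epi_iff_epi_app _).1 this (Opposite.op X)) (elt x)
  obtain ⟨y, rfl⟩ := elt_surjective (F := (representable C).obj f.right) y
  obtain ⟨u, rfl⟩ := (representable C).map_surjective y
  exact ⟨u, elt_injective hy⟩

theorem map_phiπ_eq_zero_iff {f : Arrow C} {X : C} (u : X ⟶ f.right) :
    (representable C).map u ≫ phiπ f = 0 ↔ ∃ k : X ⟶ f.left, k ≫ f.hom = u := by
  constructor
  · intro h
    obtain ⟨y, hy⟩ := (ShortComplex.ab_exact_iff _).1 (evaluation_exact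
      (ShortComplex.exact_cokernel (preadditiveYoneda.map f.hom)) (Opposite.op X))
      (elt ((representable C).map u)) (by
        change elt ((representable C).map u ≫ phiπ f) = 0
        rw [h]; rfl)
    obtain ⟨y, rfl⟩ := elt_surjective (F := (representable C).obj f.left) y
    obtain ⟨k, rfl⟩ := (representable C).map_surjective y
    refine ⟨k, (representable C).map_injective (elt_injective ?_)⟩
    rw [Functor.map_comp]
    exact hy
  · rintro ⟨k, rfl⟩
    rw [Functor.map_comp, Category.assoc, map_phiπ, comp_zero]

/-- A sequence `(-, X₁) ⟶ (-, X₀) ⟶ F ⟶ 0` that is exact on representables presents `F`. -/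
theorem nonempty_iso_of_presentation {f : Arrow C} {F : ModFP C}
    (π : (representable C).obj f.right ⟶ F)
    (zero : preadditiveYoneda.map f.hom ≫ π.hom = 0)
    (h : (ShortComplex.mk (preadditiveYoneda.map f.hom) π.hom zero).Exact) (hπ : Epi π.hom) :
    Nonempty ((Phi C).obj f ≅ F) := by
  have : Epi (ShortComplex.mk (preadditiveYoneda.map f.hom) π.hom zero).g := hπ
  exact ⟨(isFinitelyPresented C).isoMk
    ((cokernelIsCokernel (preadditiveYoneda.map f.hom)).coconePointUniqueUpToIso h.gIsCokernel)⟩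

theorem exists_iso_phi (F : ModFP C) : ∃ f : Arrow C, Nonempty ((Phi C).obj f ≅ F) := by
  obtain ⟨X₁, X₀, f, π, zero, h, hπ⟩ := F.property
  exact ⟨Arrow.mk f, nonempty_iso_of_presentation (f := Arrow.mk f) (ObjectProperty.homMk π)
    zero h hπ⟩

theorem phi_iso_of_modShortExact {f : Arrow C} {F : ModFP C}
    (π : (representable C).obj f.right ⟶ F)
    (h : ModShortExact ((representable C).map f.hom) π) : Nonempty ((Phi C).obj f ≅ F) := by
  obtain ⟨zero, h⟩ := h
  exact nonempty_iso_of_presentation π zero h.exact h.epi_g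

theorem modShortExact_phiπ {f : Arrow C} (hf : Mono f.hom) :
    ModShortExact ((representable C).map f.hom) (phiπ f) := by
  rw [modShortExact_iff]
  refine ⟨map_phiπ f, fun X x hx => ?_, fun X x hx => ?_, fun X x => ?_⟩
  · obtain ⟨x, rfl⟩ := (representable C).map_surjective x
    rw [← Functor.map_comp, ← (representable C).map_zero, (representable C).map_injective.eq_iff]
      at hx
    rw [zero_of_comp_mono _ hx, Functor.map_zero]
  · obtain ⟨x, rfl⟩ := (representable C).map_surjective x
    obtain ⟨k, rfl⟩ := (map_phiπ_eq_zero_iff x).1 hx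
    exact ⟨(representable C).map k, by rw [Functor.map_comp]⟩
  · obtain ⟨u, rfl⟩ := exists_lift_phiπ x
    exact ⟨_, rfl⟩

theorem mono_of_modShortExact {f : Arrow C} {F : ModFP C}
    {π : (representable C).obj f.right ⟶ F}
    (h : ModShortExact ((representable C).map f.hom) π) : Mono f.hom := by
  rw [modShortExact_iff] at h
  refine Preadditive.mono_of_cancel_zero _ fun g hg => (representable C).map_injective ?_
  rw [Functor.map_zero]
  apply h.2.1
  rw [← Functor.map_comp, hg, Functor.map_zero]

theorem psi_iff {T : ObjectProperty (ModFP C)} [T.IsClosedUnderIsomorphisms] (f : Arrow C) :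
    Psi T f ↔ Mono f.hom ∧ T ((Phi C).obj f) := by
  constructor
  · rintro ⟨F, π, hF, h⟩
    obtain ⟨e⟩ := phi_iso_of_modShortExact π h
    exact ⟨mono_of_modShortExact h, T.prop_of_iso e.symm hF⟩
  · rintro ⟨hf, hT⟩
    exact ⟨_, phiπ f, hT, modShortExact_phiπ hf⟩

theorem phi_map_eq_zero_iff {f g : Arrow C} (h : f ⟶ g) :
    (Phi C).map h = 0 ↔ ∃ k : f.right ⟶ g.left, k ≫ g.hom = h.right := by
  rw [← map_phiπ_eq_zero_iff, ← phiπ_naturality, ← cancel_epi (phiπ f), comp_zero]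

instance : (Phi C).Additive where
  map_add {f _ _ _} := by
    rw [← cancel_epi (phiπ f), Preadditive.comp_add, phiπ_naturality, phiπ_naturality,
      phiπ_naturality, ← Preadditive.add_comp, ← Functor.map_add]
    rfl

/-- Comparison of presentations: a map of functors lifts to the covers, then to the relations. -/
instance : (Phi C).Full where
  map_surjective {f g} h := by
    obtain ⟨u, hu⟩ := exists_lift_phiπ (phiπ f ≫ h)
    obtain ⟨k, hk⟩ := (map_phiπ_eq_zero_iff (f := g) (f.hom ≫ u)).1 (by
      rw [Functor.map_comp, Category.assoc, hu, ← Category.assoc, map_phiπ, zero_comp])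
    refine ⟨Arrow.homMk k u hk, ?_⟩
    rw [← cancel_epi (phiπ f), phiπ_naturality]
    exact hu

theorem phi_map_eq_iff {f g : Arrow C} (x y : f ⟶ g) :
    (Phi C).map x = (Phi C).map y ↔ (Preadditive.RightFreyd.quotient C).map x =
      (Preadditive.RightFreyd.quotient C).map y := by
  rw [Preadditive.RightFreyd.quotient_map_eq_iff, ← sub_eq_zero, ← Functor.map_sub,
    phi_map_eq_zero_iff]
  exact ⟨fun ⟨k, hk⟩ => ⟨⟨k, hk.symm⟩⟩, fun ⟨h⟩ => ⟨h.hom, h.comm.symm⟩⟩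

theorem homotopyEquivalent_iff (f g : Arrow C) :
    HomotopyEquivalent f g ↔ Nonempty ((Phi C).obj f ≅ (Phi C).obj g) := by
  constructor
  · rintro ⟨e⟩
    obtain ⟨x, hx⟩ := (Preadditive.RightFreyd.quotient C).map_surjective e.hom
    obtain ⟨y, hy⟩ := (Preadditive.RightFreyd.quotient C).map_surjective e.inv
    refine ⟨⟨(Phi C).map x, (Phi C).map y, ?_, ?_⟩⟩ <;>
    · rw [← Functor.map_comp, ← CategoryTheory.Functor.map_id, phi_map_eq_iff]
      simp [hx, hy]
  · rintro ⟨e⟩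
    obtain ⟨x, hx⟩ := (Phi C).map_surjective e.hom
    obtain ⟨y, hy⟩ := (Phi C).map_surjective e.inv
    refine ⟨⟨(Preadditive.RightFreyd.quotient C).map x,
      (Preadditive.RightFreyd.quotient C).map y, ?_, ?_⟩⟩ <;>
    · rw [← Functor.map_comp, ← CategoryTheory.Functor.map_id, ← phi_map_eq_iff]
      simp [hx, hy]

/-- Epimorphisms here are those of `mod(C)`, not known in advance to be pointwise surjective. The
proof extracts surjectivity from a presentation of the cokernel of `e`. -/
theorem projective_representable [HasBinaryBiproducts C] (X : C) :
    Projective ((representable C).obj X) where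
  factors {E F} t e he := by
    obtain ⟨f, ⟨i⟩⟩ := exists_iso_phi F
    obtain ⟨g, ⟨j⟩⟩ := exists_iso_phi E
    obtain ⟨u, hu⟩ := exists_lift_phiπ (phiπ g ≫ j.hom ≫ e ≫ i.inv)
    -- `Phi` sends `q` to the cokernel of `e`, up to the isomorphisms `i`, `j`; it is zero because
    -- `e` is epi. So the identity of `f.right` is a sum of a part through `f.hom`, which dies in
    -- `Φ(f)`, and a part through `u`, which lifts to `E`.
    let q : f ⟶ Arrow.mk (biprod.desc f.hom u) := Arrow.homMk biprod.inl (𝟙 _) (by simp)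
    have hq : (Phi C).map q = 0 := by
      rw [← cancel_epi (phiπ g ≫ j.hom ≫ e ≫ i.inv), ← hu, Category.assoc, phiπ_naturality,
        ← Functor.map_comp_assoc, comp_zero, map_phiπ_eq_zero_iff]
      exact ⟨biprod.inr, by simp [q]⟩
    obtain ⟨k, hk⟩ := (phi_map_eq_zero_iff q).1 hq
    obtain ⟨w, hw⟩ := exists_lift_phiπ (t ≫ i.inv)
    change k ≫ biprod.desc f.hom u = 𝟙 _ at hk
    have hk' : (k ≫ biprod.fst) ≫ f.hom + (k ≫ biprod.snd) ≫ u = 𝟙 _ := by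
      simpa [biprod.desc_eq] using hk
    refine ⟨(representable C).map (w ≫ k ≫ biprod.snd) ≫ phiπ g ≫ j.hom, ?_⟩
    rw [← cancel_mono i.inv]
    simp only [Category.assoc]
    rw [← hu, ← hw, ← Functor.map_comp_assoc, ← sub_eq_zero, ← Preadditive.sub_comp,
      ← Functor.map_sub, map_phiπ_eq_zero_iff]
    refine ⟨-(w ≫ k ≫ biprod.fst), ?_⟩
    have := congrArg (w ≫ ·) hk'
    simp only [Preadditive.comp_add, Category.comp_id, Category.assoc] at this
    rw [eq_sub_iff_add_eq, Preadditive.neg_comp, neg_add_eq_iff_eq_add]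
    simpa using this.symm

/-- A projective is a retract of a representable; by full faithfulness the idempotent lives in `C`,
where it splits since kernels exist. -/
theorem exists_iso_representable_of_projective [HasKernels C] (P : ModFP C) [Projective P] :
    ∃ X : C, Nonempty ((representable C).obj X ≅ P) := by
  have : IsIdempotentComplete C :=
    (Idempotents.isIdempotentComplete_iff_idempotents_have_kernels C).2 fun X p _ => inferInstance
  obtain ⟨f, ⟨i⟩⟩ := exists_iso_phi P
  let s := Projective.factorThru i.inv (phiπ f)
  have hs : s ≫ phiπ f ≫ i.hom = 𝟙 _ := by
    simp [s]
  obtain ⟨p, hp⟩ := (representable C).map_surjective ((phiπ f ≫ i.hom) ≫ s)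
  obtain ⟨Y, a, b, hab, hba⟩ := IsIdempotentComplete.idempotents_split f.right p
    ((representable C).map_injective (by
      rw [Functor.map_comp, hp, Category.assoc, ← Category.assoc s, hs, Category.id_comp]))
  refine ⟨Y, ⟨⟨(representable C).map a ≫ phiπ f ≫ i.hom, s ≫ (representable C).map b, ?_, ?_⟩⟩⟩
  · have : (phiπ f ≫ i.hom) ≫ s ≫ (representable C).map b = (representable C).map (p ≫ b) := by
      rw [Functor.map_comp, hp]; simp
    rw [Category.assoc, this, ← Functor.map_comp, ← hba, Category.assoc, hab, ← Category.assoc,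
      hab]
    simp
  · rw [Category.assoc, ← Functor.map_comp_assoc, hba, hp]
    simp only [Category.assoc] at hs ⊢
    rw [reassoc_of% hs, hs]

end Functors

/-! ### Sequences with split columns, relative projectives and relative Ext. -/

noncomputable section RelativeExact

variable {C : Type u} [Category.{v} C]

theorem mono_of_arrow_iso {M M' : Arrow C} (e : M' ≅ M) (h : Mono M.hom) : Mono M'.hom := by
  have : IsIso e.hom.left := ⟨e.inv.left, by simp [← Arrow.comp_left], by simp [← Arrow.comp_left]⟩
  have : Mono (M'.hom ≫ e.hom.right) := by
    rw [← Arrow.w]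
    infer_instance
  exact mono_of_mono _ e.hom.right

theorem mono_of_isZero_left {f : Arrow C} (hf : IsZero f.left) : Mono f.hom :=
  ⟨fun _ _ _ => hf.eq_of_tgt _ _⟩

variable [Preadditive C]

theorem splitShort_iff {X Y Z : C} (a : X ⟶ Y) (b : Y ⟶ Z) :
    SplitShort a b ↔ ∃ (r : Y ⟶ X) (s : Z ⟶ Y),
      a ≫ b = 0 ∧ a ≫ r = 𝟙 X ∧ s ≫ b = 𝟙 Z ∧ r ≫ a + b ≫ s = 𝟙 Y := by
  constructor
  · rintro ⟨zero, ⟨σ⟩⟩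
    exact ⟨σ.r, σ.s, zero, σ.f_r, σ.s_g, σ.id⟩
  · rintro ⟨r, s, zero, har, hsb, h⟩
    exact ⟨zero, ⟨{ r := r, s := s, f_r := har, s_g := hsb, id := h }⟩⟩

theorem SplitShort.epi {X Y Z : C} {a : X ⟶ Y} {b : Y ⟶ Z} (h : SplitShort a b) : Epi b := by
  obtain ⟨r, s, -, -, hs, -⟩ := (splitShort_iff _ _).1 h
  have : IsSplitEpi b := ⟨⟨⟨s, hs⟩⟩⟩
  infer_instance

theorem SplitShort.mono {X Y Z : C} {a : X ⟶ Y} {b : Y ⟶ Z} (h : SplitShort a b) : Mono a := by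
  obtain ⟨r, s, -, hr, -, -⟩ := (splitShort_iff _ _).1 h
  have : IsSplitMono a := ⟨⟨⟨r, hr⟩⟩⟩
  infer_instance

theorem splitShort_id {X Z : C} (hX : IsZero X) (a : X ⟶ Z) : SplitShort a (𝟙 Z) :=
  (splitShort_iff _ _).2
    ⟨0, 𝟙 Z, hX.eq_of_src _ _, hX.eq_of_src _ _, Category.id_comp _, by simp⟩

theorem splitShort_biprod [HasBinaryBiproducts C] (X Z : C) :
    SplitShort (biprod.inl : X ⟶ X ⊞ Z) biprod.snd :=
  (splitShort_iff _ _).2 ⟨biprod.fst, biprod.inr, by simp, by simp, by simp, by simp⟩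

theorem splitShort_graph [HasBinaryBiproducts C] {X Z : C} (f : X ⟶ Z) :
    SplitShort (biprod.lift (𝟙 X) (-f)) (biprod.desc f (𝟙 Z)) :=
  (splitShort_iff _ _).2 ⟨biprod.fst, biprod.inr, by simp, by simp, by simp, by
    refine biprod.hom_ext' _ _ ?_ ?_ <;> refine biprod.hom_ext _ _ ?_ ?_ <;> simp⟩

/-- Both columns of the sequence `N ⟶ E ⟶ M` of maps are split short exact. -/
def ColumnsSplit {N E M : Arrow C} (i : N ⟶ E) (p : E ⟶ M) : Prop :=
  SplitShort i.left p.left ∧ SplitShort i.right p.right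

/-- Every morphism `M.left ⟶ N.right` is a sum of a morphism that factors through `N` and one that
factors through `M`; for monomorphisms this is the vanishing of `Ext¹(Φ M, Φ N)`. -/
def CrossVanishing (M N : Arrow C) : Prop :=
  ∀ s : M.left ⟶ N.right, ∃ (a : M.left ⟶ N.left) (b : M.right ⟶ N.right),
    a ≫ N.hom + M.hom ≫ b = s

theorem CrossVanishing.of_iso {M M' N : Arrow C} (h : CrossVanishing M N) (e : M' ≅ M) :
    CrossVanishing M' N := by
  intro s
  obtain ⟨a, b, hab⟩ := h (e.inv.left ≫ s)
  refine ⟨e.hom.left ≫ a, e.hom.right ≫ b, ?_⟩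
  rw [← Arrow.w_assoc, Category.assoc, ← Preadditive.comp_add, hab, ← Category.assoc,
    ← Arrow.comp_left, e.hom_inv_id, Arrow.id_left, Category.id_comp]

section

variable {N E M : Arrow C} {i : N ⟶ E} {p : E ⟶ M}

theorem ColumnsSplit.zero (h : ColumnsSplit i p) : i ≫ p = 0 := by
  obtain ⟨⟨z₀, -⟩, ⟨z₁, -⟩⟩ := h
  exact Arrow.hom_ext _ _ z₀ z₁

theorem ColumnsSplit.epi (h : ColumnsSplit i p) : Epi p := by
  have : Epi p.left := h.1.epi
  have : Epi p.right := h.2.epi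
  refine ⟨fun x y hxy => Arrow.hom_ext _ _ ?_ ?_⟩
  · rw [← cancel_epi p.left, ← Arrow.comp_left, hxy, Arrow.comp_left]
  · rw [← cancel_epi p.right, ← Arrow.comp_right, hxy, Arrow.comp_right]

theorem ColumnsSplit.mono (h : ColumnsSplit i p) : Mono i := by
  have : Mono i.left := h.1.mono
  have : Mono i.right := h.2.mono
  refine ⟨fun x y hxy => Arrow.hom_ext _ _ ?_ ?_⟩
  · rw [← cancel_mono i.left, ← Arrow.comp_left, hxy, Arrow.comp_left]
  · rw [← cancel_mono i.right, ← Arrow.comp_right, hxy, Arrow.comp_right]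

theorem ColumnsSplit.desc (h : ColumnsSplit i p) {X : Arrow C} (φ : E ⟶ X) (hφ : i ≫ φ = 0) :
    ∃ φ' : M ⟶ X, p ≫ φ' = φ := by
  simp only [ColumnsSplit, splitShort_iff] at h
  obtain ⟨⟨r₀, s₀, -, -, h₀, e₀⟩, ⟨r₁, s₁, -, -, h₁, e₁⟩⟩ := h
  have hφ₀ : i.left ≫ φ.left = 0 := by rw [← Arrow.comp_left, hφ]; rfl
  have hφ₁ : i.right ≫ φ.right = 0 := by rw [← Arrow.comp_right, hφ]; rfl
  have k₀ : p.left ≫ s₀ ≫ φ.left = φ.left := by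
    simpa [hφ₀] using congrArg (· ≫ φ.left) e₀
  have k₁ : p.right ≫ s₁ ≫ φ.right = φ.right := by
    simpa [hφ₁] using congrArg (· ≫ φ.right) e₁
  have : IsSplitEpi p.left := ⟨⟨⟨s₀, h₀⟩⟩⟩
  refine ⟨Arrow.homMk (s₀ ≫ φ.left) (s₁ ≫ φ.right) ?_, Arrow.hom_ext _ _ k₀ k₁⟩
  rw [← cancel_epi p.left, Category.assoc, reassoc_of% k₀, Arrow.w_assoc, k₁, Arrow.w]

theorem ColumnsSplit.lift (h : ColumnsSplit i p) {X : Arrow C} (φ : X ⟶ E) (hφ : φ ≫ p = 0) :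
    ∃ φ' : X ⟶ N, φ' ≫ i = φ := by
  simp only [ColumnsSplit, splitShort_iff] at h
  obtain ⟨⟨r₀, s₀, -, h₀, -, e₀⟩, ⟨r₁, s₁, -, h₁, -, e₁⟩⟩ := h
  have hφ₀ : φ.left ≫ p.left = 0 := by rw [← Arrow.comp_left, hφ]; rfl
  have hφ₁ : φ.right ≫ p.right = 0 := by rw [← Arrow.comp_right, hφ]; rfl
  have k₀ : (φ.left ≫ r₀) ≫ i.left = φ.left := by
    simpa [reassoc_of% hφ₀] using congrArg (φ.left ≫ ·) e₀
  have k₁ : (φ.right ≫ r₁) ≫ i.right = φ.right := by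
    simpa [reassoc_of% hφ₁] using congrArg (φ.right ≫ ·) e₁
  have : IsSplitMono i.right := ⟨⟨⟨r₁, h₁⟩⟩⟩
  refine ⟨Arrow.homMk (φ.left ≫ r₀) (φ.right ≫ r₁) ?_, Arrow.hom_ext _ _ k₀ k₁⟩
  rw [← cancel_mono i.right, Category.assoc, ← Arrow.w, ← Category.assoc, k₀, Category.assoc, k₁,
    Arrow.w]

/-- This is exactness of `Hom(E, X) ⟶ Hom(N, X) ⟶ Ext¹(M, X)`, with the last term zero. -/
theorem ColumnsSplit.extend (h : ColumnsSplit i p) {X : Arrow C} (hX : CrossVanishing M X)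
    (φ : N ⟶ X) : ∃ ψ : E ⟶ X, i ≫ ψ = φ := by
  simp only [ColumnsSplit, splitShort_iff] at h
  obtain ⟨⟨r₀, s₀, z₀, h₀, -, e₀⟩, ⟨r₁, s₁, z₁, h₁, -, e₁⟩⟩ := h
  -- `s₀ ≫ E.hom ≫ r₁` is the off-diagonal entry of `E` in the chosen splittings; composing with
  -- `φ.right` pushes the extension out along `φ`.
  obtain ⟨a, b, hab⟩ := hX (s₀ ≫ E.hom ≫ r₁ ≫ φ.right)
  have key : E.hom ≫ r₁ = r₀ ≫ N.hom + p.left ≫ s₀ ≫ E.hom ≫ r₁ := by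
    calc E.hom ≫ r₁ = (r₀ ≫ i.left + p.left ≫ s₀) ≫ E.hom ≫ r₁ := by rw [e₀, Category.id_comp]
      _ = r₀ ≫ (i.left ≫ E.hom) ≫ r₁ + p.left ≫ s₀ ≫ E.hom ≫ r₁ := by simp
      _ = _ := by rw [Arrow.w, Category.assoc, h₁, Category.comp_id]
  refine ⟨Arrow.homMk (r₀ ≫ φ.left + p.left ≫ a) (r₁ ≫ φ.right - p.right ≫ b) ?_,
    Arrow.hom_ext _ _ ?_ ?_⟩
  · rw [Preadditive.comp_sub, reassoc_of% key, ← Arrow.w_assoc, Preadditive.add_comp,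
      Preadditive.add_comp]
    simp only [Category.assoc]
    rw [← hab, Arrow.w, Preadditive.comp_add]
    abel
  · simp [reassoc_of% h₀, reassoc_of% z₀]
  · simp [reassoc_of% h₁, reassoc_of% z₁]

theorem ColumnsSplit.isSplitEpi (h : ColumnsSplit i p) (hMN : CrossVanishing M N) :
    IsSplitEpi p := by
  obtain ⟨ψ, hψ⟩ := h.extend hMN (𝟙 N)
  obtain ⟨σ, hσ⟩ := h.desc (𝟙 E - ψ ≫ i) (by
    rw [Preadditive.comp_sub, reassoc_of% hψ, Category.comp_id, sub_self])
  have := h.epi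
  refine ⟨⟨⟨σ, ?_⟩⟩⟩
  rw [← cancel_epi p, reassoc_of% hσ, Preadditive.sub_comp, Category.assoc, h.zero]
  simp

theorem ColumnsSplit.mono_hom (h : ColumnsSplit i p) (hN : Mono N.hom) (hM : Mono M.hom) :
    Mono E.hom := by
  simp only [ColumnsSplit, splitShort_iff] at h
  obtain ⟨⟨r₀, s₀, z₀, h₀, -, e₀⟩, ⟨r₁, s₁, z₁, h₁, -, e₁⟩⟩ := h
  have : IsSplitMono i.right := ⟨⟨⟨r₁, h₁⟩⟩⟩
  refine Preadditive.mono_of_cancel_zero _ fun x hx => ?_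
  have hxp : x ≫ p.left = 0 := by
    rw [← cancel_mono M.hom, Category.assoc, Arrow.w, reassoc_of% hx, zero_comp, zero_comp]
  have hxr : (x ≫ r₀) ≫ i.left = x := by
    simpa [reassoc_of% hxp] using congrArg (x ≫ ·) e₀
  have : x ≫ r₀ = 0 := by
    rw [← cancel_mono N.hom, ← cancel_mono i.right, Category.assoc, ← Arrow.w, ← Category.assoc,
      hxr, hx]
    simp
  rw [← hxr, this, zero_comp]

end

section Extensions

variable [HasBinaryBiproducts C] {M N : Arrow C} (s : M.left ⟶ N.right)

/-- The extension of `M` by `N` with split columns that is determined by `s`. -/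
def extArrow : Arrow C :=
  Arrow.mk (biprod.desc (biprod.lift N.hom 0) (biprod.lift s M.hom) :
    N.left ⊞ M.left ⟶ N.right ⊞ M.right)

/-- The inclusion of `N` in the extension determined by `s`. -/
def extIncl : N ⟶ extArrow s :=
  Arrow.homMk biprod.inl biprod.inl (by
    refine biprod.hom_ext _ _ ?_ ?_ <;> simp [extArrow])

/-- The projection of the extension determined by `s` onto `M`. -/
def extProj : extArrow s ⟶ M :=
  Arrow.homMk biprod.snd biprod.snd (by
    refine biprod.hom_ext' _ _ ?_ ?_ <;> simp [extArrow])

theorem columnsSplit_ext : ColumnsSplit (extIncl s) (extProj s) :=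
  ⟨splitShort_biprod _ _, splitShort_biprod _ _⟩

variable {s} in
-- A section up to the homotopy `k` suffices, so the lemma serves both maps (`k = 0`) and functors.
-- Since `M.hom` is mono, the `M.left` component of the section is `1 + M.hom ≫ k`; the other
-- component of the commutative square then solves for `s`.
theorem exists_of_section_ext (hM : Mono M.hom) (σ : M ⟶ extArrow s) (k : M.right ⟶ M.left)
    (hk : k ≫ M.hom = σ.right ≫ (extProj s).right - 𝟙 M.right) :
    ∃ (a : M.left ⟶ N.left) (b : M.right ⟶ N.right), a ≫ N.hom + M.hom ≫ b = s := by
  obtain ⟨x, y, hw, hy⟩ : ∃ (x : M.left ⟶ N.left ⊞ M.left) (y : M.right ⟶ N.right ⊞ M.right),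
      x ≫ biprod.desc (biprod.lift N.hom 0) (biprod.lift s M.hom) = M.hom ≫ y ∧
        y ≫ biprod.snd = k ≫ M.hom + 𝟙 M.right :=
    ⟨σ.left, σ.right, σ.w, sub_eq_iff_eq_add.1 hk.symm⟩
  have h₁ : x ≫ biprod.fst ≫ N.hom + x ≫ biprod.snd ≫ s = M.hom ≫ y ≫ biprod.fst := by
    simpa [biprod.desc_eq] using congrArg (· ≫ biprod.fst) hw
  have h₂ : x ≫ biprod.snd ≫ M.hom = M.hom ≫ y ≫ biprod.snd := by
    simpa [biprod.desc_eq] using congrArg (· ≫ biprod.snd) hw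
  have h₃ : x ≫ biprod.snd = M.hom ≫ k + 𝟙 M.left := by
    rw [← cancel_mono M.hom, Category.assoc, h₂, hy]
    simp
  refine ⟨-(x ≫ biprod.fst), y ≫ biprod.fst - k ≫ s, ?_⟩
  rw [Preadditive.comp_sub, ← h₁, reassoc_of% h₃]
  simp only [Preadditive.neg_comp, Preadditive.add_comp, Category.assoc, Category.id_comp]
  abel

end Extensions

section ZeroObject

variable [HasZeroObject C]

theorem isZero_rightFunctor_left (X : C) :
    IsZero ((Preadditive.RightFreyd.rightFunctor C).obj X).left := isZero_zero C

open ZeroObject in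
/-- The relative syzygies of a monomorphism. -/
def resSyzygy (M : Arrow C) : ℕ → Arrow C
  | 0 => M
  | 1 => (Preadditive.RightFreyd.rightFunctor C).obj M.left
  | _ + 2 => (Preadditive.RightFreyd.rightFunctor C).obj 0

theorem isZero_resSyzygy_left (M : Arrow C) : ∀ n, IsZero (resSyzygy M (n + 1)).left
  | 0 => isZero_rightFunctor_left _
  | _ + 1 => isZero_rightFunctor_left _

theorem isZero_resSyzygy (M : Arrow C) (n : ℕ) : IsZero (resSyzygy M (n + 2)) := by
  rw [IsZero.iff_id_eq_zero]
  exact Arrow.hom_ext _ _ ((isZero_zero C).eq_of_src _ _) (IsZero.eq_of_src (isZero_zero C) _ _)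

end ZeroObject

section Kernels

variable [HasKernels C]

theorem FExact.columnsSplit {N E M : Arrow C} {i : N ⟶ E} {p : E ⟶ M} (h : FExact i p) :
    ColumnsSplit i p := h.2

/-- With monomorphisms at both ends the middle is one too, so the column of kernels is zero and
splits trivially. -/
theorem ColumnsSplit.fExact {N E M : Arrow C} {i : N ⟶ E} {p : E ⟶ M} (h : ColumnsSplit i p)
    (hN : Mono N.hom) (hM : Mono M.hom) : FExact i p := by
  have hE := h.mono_hom hN hM
  have key : ∀ f : Arrow C, Mono f.hom → IsZero ((ker C).obj f) := fun f hf => by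
    have : IsZero (kernel f.hom) := by
      rw [IsZero.iff_id_eq_zero, ← cancel_mono (kernel.ι f.hom), ← cancel_mono f.hom]
      simp
    exact this
  exact ⟨(splitShort_iff _ _).2 ⟨0, 0, (key _ hN).eq_of_src _ _, (key _ hN).eq_of_src _ _,
    (key _ hM).eq_of_src _ _, (key _ hE).eq_of_src _ _⟩, h⟩

theorem FProjective.of_isZero_left {P : Arrow C} (hP : IsZero P.left) : FProjective P := by
  intro N E M i p h φ
  obtain ⟨-, s, -, -, hs, -⟩ := (splitShort_iff _ _).1 h.2.2
  exact ⟨Arrow.homMk 0 (φ.right ≫ s) (hP.eq_of_src _ _),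
    Arrow.hom_ext _ _ (hP.eq_of_src _ _) (by simp [hs])⟩

/-- A map from `A ⟶ A ⊞ B` to `M` is a free choice of `A ⟶ M.left` and `B ⟶ M.right`, and each lifts
along a split column. -/
theorem FProjective.biprod_inl [HasBinaryBiproducts C] (A B : C) :
    FProjective (Arrow.mk (biprod.inl : A ⟶ A ⊞ B)) := by
  intro N E M i p h φ
  obtain ⟨-, s₀, -, -, hs₀, -⟩ := (splitShort_iff _ _).1 h.2.1
  obtain ⟨-, s₁, -, -, hs₁, -⟩ := (splitShort_iff _ _).1 h.2.2
  have hw : φ.left ≫ M.hom = biprod.inl ≫ φ.right := φ.w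
  refine ⟨Arrow.homMk (φ.left ≫ s₀)
    (biprod.desc (φ.left ≫ s₀ ≫ E.hom) (biprod.inr ≫ φ.right ≫ s₁)) (by simp),
    Arrow.hom_ext _ _ (by simp [hs₀]) ?_⟩
  refine biprod.hom_ext' _ _ ?_ ?_
  · simp [← Arrow.w, reassoc_of% hs₀, hw]
  · simp [hs₁]

/-- In an `F`-exact sequence with `F`-projective middle term whose right end has relative
projective dimension at most one, the left end is `F`-projective. -/
theorem FProjective.syzygy {K P R Q M : Arrow C} {i : K ⟶ P} {p : P ⟶ M} {i' : R ⟶ Q}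
    {p' : Q ⟶ M} (h : FExact i p) (h' : FExact i' p') (hP : FProjective P) (hQ : FProjective Q)
    (hR : FProjective R) : FProjective K := by
  obtain ⟨α, hα⟩ := hP _ _ _ _ _ h' p
  obtain ⟨β, hβ⟩ := hQ _ _ _ _ _ h p'
  have z := h.columnsSplit.zero
  have z' := h'.columnsSplit.zero
  obtain ⟨α', hα'⟩ := h'.columnsSplit.lift (i ≫ α) (by rw [Category.assoc, hα, z])
  obtain ⟨β', hβ'⟩ := h.columnsSplit.lift (i' ≫ β) (by rw [Category.assoc, hβ, z'])
  obtain ⟨k, hk⟩ := h.columnsSplit.lift (𝟙 P - α ≫ β) (by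
    rw [Preadditive.sub_comp, Category.assoc, hβ, hα, Category.id_comp, sub_self])
  have := h.columnsSplit.mono
  -- Schanuel-type comparison: the identity of `K` is a sum of a map through `R` and a map through
  -- `P`, both relatively projective.
  have hid : α' ≫ β' + i ≫ k = 𝟙 K := by
    rw [← cancel_mono i, Preadditive.add_comp, Category.assoc, Category.assoc, hk, hβ',
      reassoc_of% hα', Preadditive.comp_sub]
    simp
  intro N E M' j q hjq φ
  obtain ⟨x, hx⟩ := hR _ _ _ _ _ hjq (β' ≫ φ)
  obtain ⟨y, hy⟩ := hP _ _ _ _ _ hjq (k ≫ φ)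
  refine ⟨α' ≫ x + i ≫ y, ?_⟩
  rw [Preadditive.add_comp, Category.assoc, Category.assoc, hx, hy, ← Category.assoc,
    ← Category.assoc, ← Preadditive.add_comp, hid, Category.id_comp]

theorem FProjective.exists_retraction {K P M : Arrow C} {i : K ⟶ P} {p : P ⟶ M} (h : FExact i p)
    (hM : FProjective M) : ∃ r : P ⟶ K, i ≫ r = 𝟙 K := by
  obtain ⟨s, hs⟩ := hM _ _ _ _ _ h (𝟙 M)
  obtain ⟨r, hr⟩ := h.columnsSplit.lift (𝟙 P - p ≫ s) (by
    rw [Preadditive.sub_comp, Category.assoc, hs]; simp)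
  have := h.columnsSplit.mono
  refine ⟨r, ?_⟩
  rw [← cancel_mono i, Category.assoc, hr, Preadditive.comp_sub, reassoc_of% h.columnsSplit.zero]
  simp

theorem FProjective.of_fExact {K P M : Arrow C} {i : K ⟶ P} {p : P ⟶ M} (h : FExact i p)
    (hP : FProjective P) (hM : FProjective M) : FProjective K := by
  obtain ⟨r, hr⟩ := FProjective.exists_retraction h hM
  intro N E M' j q hjq φ
  obtain ⟨x, hx⟩ := hP _ _ _ _ _ hjq (r ≫ φ)
  exact ⟨i ≫ x, by rw [Category.assoc, hx, reassoc_of% hr]⟩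

section Biproducts

variable [HasBinaryBiproducts C]

theorem fExtOneVanishes_iff {M N : Arrow C} (hM : Mono M.hom) (hN : Mono N.hom) :
    FExtOneVanishes M N ↔ CrossVanishing M N := by
  constructor
  · intro h s
    have : IsSplitEpi (extProj s) := h _ _ _ ((columnsSplit_ext s).fExact hN hM)
    have hσ : section_ (extProj s) ≫ extProj s = 𝟙 M := IsSplitEpi.id _
    refine exists_of_section_ext hM (section_ (extProj s)) 0 ?_
    rw [zero_comp, eq_comm, sub_eq_zero]
    exact congrArg (fun t => t.right) hσ
  · intro h E i p hip
    exact hip.columnsSplit.isSplitEpi h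

end Biproducts

section Resolution

variable [HasZeroObject C] [HasBinaryBiproducts C]

/-- The inclusion in the relative projective resolution of length one of a monomorphism. -/
def resIncl (M : Arrow C) : (Preadditive.RightFreyd.rightFunctor C).obj M.left ⟶
    Arrow.mk (biprod.inl : M.left ⟶ M.left ⊞ M.right) :=
  Arrow.homMk 0 (biprod.lift (𝟙 _) (-M.hom)) ((isZero_rightFunctor_left _).eq_of_src _ _)

/-- The projection in the relative projective resolution of length one of a monomorphism. -/
def resProj (M : Arrow C) : Arrow.mk (biprod.inl : M.left ⟶ M.left ⊞ M.right) ⟶ M :=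
  Arrow.homMk (𝟙 _) (biprod.desc M.hom (𝟙 _)) (by simp)

theorem fExact_res {M : Arrow C} (hM : Mono M.hom) : FExact (resIncl M) (resProj M) := by
  exact ColumnsSplit.fExact ⟨splitShort_id (isZero_rightFunctor_left _) _, splitShort_graph M.hom⟩
    (mono_of_isZero_left (isZero_rightFunctor_left _)) hM

/-- The terms of the relative projective resolution of length one of a monomorphism. -/
def resTerm (M : Arrow C) : ℕ → Arrow C
  | 0 => Arrow.mk (biprod.inl : M.left ⟶ M.left ⊞ M.right)
  | n + 1 => resSyzygy M (n + 1)

/-- The relative projective resolution of length one of a monomorphism. -/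
def monoResolution {M : Arrow C} (hM : Mono M.hom) : FResolution M where
  P := resTerm M
  K := resSyzygy M
  incl
    | 0 => resIncl M
    | _ + 1 => 0
  proj
    | 0 => resProj M
    | _ + 1 => 𝟙 _
  zeroth := Iso.refl _
  fProjective
    | 0 => FProjective.biprod_inl _ _
    | n + 1 => .of_isZero_left (isZero_resSyzygy_left M n)
  fExact
    | 0 => fExact_res hM
    | n + 1 => by
      refine ColumnsSplit.fExact ⟨splitShort_id (isZero_resSyzygy_left M _) _,
        splitShort_id (isZero_zero C) _⟩
        (mono_of_isZero_left (isZero_resSyzygy_left M _))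
        (mono_of_isZero_left (isZero_resSyzygy_left M _))

theorem fPdimLE_one {M : Arrow C} (hM : Mono M.hom) : FPdimLE M 1 := by
  refine ⟨monoResolution hM, fun m hm => ?_⟩
  obtain ⟨k, rfl⟩ := Nat.exists_eq_add_of_lt hm
  rw [show 1 + k + 1 = k + 2 by omega]
  exact isZero_resSyzygy M k

/-- Relative Ext is tested on every resolution, so an arbitrary one is compared with the standard
resolution of length one. -/
theorem FResolution.fProjective_syzygy {M : Arrow C} (hM : Mono M.hom) (S : FResolution M)
    (n : ℕ) : FProjective (S.K (n + 1)) := by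
  induction n with
  | zero =>
    exact FProjective.syzygy (S.fExact 0) (fExact_res (mono_of_arrow_iso S.zeroth hM))
      (S.fProjective 0) (FProjective.biprod_inl _ _)
      (.of_isZero_left (isZero_rightFunctor_left _))
  | succ n ih => exact FProjective.of_fExact (S.fExact (n + 1)) (S.fProjective _) ih

theorem fExtSuccVanishes {M N : Arrow C} (hM : Mono M.hom) (h : CrossVanishing M N) (k : ℕ) :
    FExtSuccVanishes k M N := by
  intro S φ hφ
  have := (S.fExact (k + 2)).columnsSplit.epi
  rw [FResolution.d, Category.assoc, ← comp_zero (f := S.proj (k + 1 + 1)), cancel_epi] at hφ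
  obtain ⟨φ', rfl⟩ := (S.fExact (k + 1)).columnsSplit.desc φ hφ
  have : ∃ ψ : S.P k ⟶ N, S.incl k ≫ ψ = φ' := by
    -- In degree one the extension of `φ'` is the vanishing of `Ext¹`. In higher degrees the syzygy
    -- `K (k + 1)` is already relatively projective, so the inclusion to be extended along is split.
    cases k with
    | zero => exact (S.fExact 0).columnsSplit.extend (h.of_iso S.zeroth) φ'
    | succ k =>
      obtain ⟨r, hr⟩ := FProjective.exists_retraction (S.fExact (k + 1))
        (S.fProjective_syzygy hM k)
      exact ⟨r ≫ φ', by rw [reassoc_of% hr]⟩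
  obtain ⟨ψ, rfl⟩ := this
  exact ⟨ψ, by rw [FResolution.d, Category.assoc]⟩

end Resolution

end Kernels

end RelativeExact

/-! ### Transfer of extensions and coresolutions along `Phi`, and the correspondence. -/

noncomputable section Tilting

variable {C : Type u} [Category.{v} C] [Preadditive C]

/-- The snake lemma: the connecting map starts at the kernel of `(-, M.hom)`, which is zero, so
`Φ(i)` stays injective. -/
theorem ColumnsSplit.modShortExact {N E M : Arrow C} {i : N ⟶ E} {p : E ⟶ M}
    (h : ColumnsSplit i p) (hM : Mono M.hom) :
    ModShortExact ((Phi C).map i) ((Phi C).map p) := by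
  have z := h.zero
  simp only [ColumnsSplit, splitShort_iff] at h
  obtain ⟨⟨r₀, s₀, z₀, h₀, g₀, e₀⟩, ⟨r₁, s₁, z₁, h₁, g₁, e₁⟩⟩ := h
  have : IsSplitMono i.right := ⟨⟨⟨r₁, h₁⟩⟩⟩
  rw [modShortExact_iff]
  refine ⟨by rw [← Functor.map_comp, z, Functor.map_zero], fun X x hx => ?_, fun X x hx => ?_,
    fun X x => ?_⟩
  · obtain ⟨u, rfl⟩ := exists_lift_phiπ x
    rw [Category.assoc, phiπ_naturality, ← Functor.map_comp_assoc, map_phiπ_eq_zero_iff] at hx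
    obtain ⟨k, hk⟩ := hx
    have hkp : k ≫ p.left = 0 := by
      rw [← cancel_mono M.hom, Category.assoc, Arrow.w, reassoc_of% hk, z₁]
      simp
    have hkr : (k ≫ r₀) ≫ i.left = k := by
      simpa [reassoc_of% hkp] using congrArg (k ≫ ·) e₀
    rw [map_phiπ_eq_zero_iff]
    refine ⟨k ≫ r₀, ?_⟩
    rw [← cancel_mono i.right, ← hk, Category.assoc, ← Arrow.w, ← Category.assoc, hkr]
  · obtain ⟨u, rfl⟩ := exists_lift_phiπ x
    rw [Category.assoc, phiπ_naturality, ← Functor.map_comp_assoc, map_phiπ_eq_zero_iff] at hx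
    obtain ⟨k, hk⟩ := hx
    have hz : (u - (k ≫ s₀) ≫ E.hom) ≫ p.right = 0 := by
      rw [Preadditive.sub_comp, Category.assoc, ← Arrow.w, Category.assoc, reassoc_of% g₀, hk,
        sub_self]
    have hr : ((u - (k ≫ s₀) ≫ E.hom) ≫ r₁) ≫ i.right = u - (k ≫ s₀) ≫ E.hom := by
      simpa [reassoc_of% hz] using congrArg ((u - (k ≫ s₀) ≫ E.hom) ≫ ·) e₁
    refine ⟨(representable C).map ((u - (k ≫ s₀) ≫ E.hom) ≫ r₁) ≫ phiπ N, ?_⟩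
    rw [Category.assoc, phiπ_naturality, ← Functor.map_comp_assoc, hr, Functor.map_sub,
      Preadditive.sub_comp, (map_phiπ_eq_zero_iff ((k ≫ s₀) ≫ E.hom)).2 ⟨_, rfl⟩, sub_zero]
  · obtain ⟨u, rfl⟩ := exists_lift_phiπ x
    refine ⟨(representable C).map (u ≫ s₁) ≫ phiπ E, ?_⟩
    rw [Category.assoc, phiπ_naturality, ← Functor.map_comp_assoc, Category.assoc, g₁,
      Category.comp_id]

theorem ModShortExact.of_iso {G G' H F F' : ModFP C} {a : G ⟶ H} {b : H ⟶ F}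
    (h : ModShortExact a b) (e : G' ≅ G) (e' : F ≅ F') :
    ModShortExact (e.hom ≫ a) (b ≫ e'.hom) := by
  rw [modShortExact_iff] at h ⊢
  obtain ⟨z, h₁, h₂, h₃⟩ := h
  refine ⟨by rw [Category.assoc, reassoc_of% z]; simp, fun X x hx => ?_, fun X x hx => ?_,
    fun X x => ?_⟩
  · rw [← Category.assoc] at hx
    rw [← cancel_mono e.hom, h₁ X _ hx, zero_comp]
  · obtain ⟨y, rfl⟩ := h₂ X x (by
      rw [← cancel_mono e'.hom, Category.assoc, hx, zero_comp])
    exact ⟨y ≫ e.inv, by simp⟩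
  · obtain ⟨y, hy⟩ := h₃ X (x ≫ e'.inv)
    exact ⟨y, by rw [reassoc_of% hy]; simp⟩

/-- Lift the cover of `Φ(M)` to `q` with values in `H`. On `(-, M.left)` it lands in `Φ(N)` and is
given by some `s`. Writing `s = α ≫ N.hom + M.hom ≫ β`, the first term dies in `Φ(N)`, and
correcting `q` by `β` makes it descend to a section. -/
theorem isSplitEpi_of_crossVanishing {M N : Arrow C} (h : CrossVanishing M N) {H : ModFP C}
    {a : (Phi C).obj N ⟶ H} {b : H ⟶ (Phi C).obj M} (hab : ModShortExact a b) :
    IsSplitEpi b := by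
  rw [modShortExact_iff] at hab
  obtain ⟨z, -, h₂, h₃⟩ := hab
  obtain ⟨q, hq⟩ := h₃ _ (phiπ M)
  obtain ⟨y, hy⟩ := h₂ _ ((representable C).map M.hom ≫ q) (by
    rw [Category.assoc, hq, map_phiπ])
  obtain ⟨s, rfl⟩ := exists_lift_phiπ y
  obtain ⟨α, β, rfl⟩ := h s
  obtain ⟨σ, hσ⟩ := phiπ_desc (q - (representable C).map β ≫ phiπ N ≫ a) (by
    rw [Preadditive.comp_sub, ← hy, Functor.map_add, Preadditive.add_comp,
      (map_phiπ_eq_zero_iff (α ≫ N.hom)).2 ⟨_, rfl⟩, zero_add, Functor.map_comp]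
    simp)
  refine ⟨⟨⟨σ, ?_⟩⟩⟩
  rw [← cancel_epi (phiπ M), reassoc_of% hσ, Preadditive.sub_comp, hq]
  simp [z]

/-- By fullness a section in `mod(C)` comes from a map that is a section up to homotopy. -/
theorem crossVanishing_of_isSplitEpi [HasBinaryBiproducts C] {M N : Arrow C} (hM : Mono M.hom)
    (h : ∀ (H : ModFP C) (a : (Phi C).obj N ⟶ H) (b : H ⟶ (Phi C).obj M),
      ModShortExact a b → IsSplitEpi b) : CrossVanishing M N := by
  intro s
  have : IsSplitEpi ((Phi C).map (extProj s)) :=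
    h _ _ _ ((columnsSplit_ext s).modShortExact hM)
  obtain ⟨σ, hσ⟩ := (Phi C).map_surjective (section_ ((Phi C).map (extProj s)))
  have hz : (Phi C).map (σ ≫ extProj s - 𝟙 M) = 0 := by
    rw [Functor.map_sub, Functor.map_comp, hσ, IsSplitEpi.id, CategoryTheory.Functor.map_id,
      sub_self]
  obtain ⟨k, hk⟩ := (phi_map_eq_zero_iff _).1 hz
  exact exists_of_section_ext hM σ k hk

theorem HomotopyClosed.isClosedUnderIsomorphisms {T : ObjectProperty (Arrow C)}
    (hT : HomotopyClosed T) (hm : ∀ f, T f → Mono f.hom) : T.IsClosedUnderIsomorphisms where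
  of_iso {f g} e hf := hT f g hf (mono_of_arrow_iso e.symm (hm f hf))
    ⟨(Preadditive.RightFreyd.quotient C).mapIso e⟩

theorem psi_map_iff (T : ObjectProperty (Arrow C)) (g : Arrow C) :
    Psi (T.map (Phi C)) g ↔ Mono g.hom ∧ ∃ f, T f ∧ HomotopyEquivalent f g := by
  simp only [psi_iff, ObjectProperty.prop_map_iff, homotopyEquivalent_iff]

theorem HomotopyClosed.psi_map {T : ObjectProperty (Arrow C)} (hT : HomotopyClosed T)
    (hm : ∀ f, T f → Mono f.hom) : Psi (T.map (Phi C)) = T := by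
  ext g
  rw [psi_map_iff]
  exact ⟨fun ⟨hg, f, hf, e⟩ => hT f g hf hg e,
    fun hg => ⟨hm g hg, g, hg, ⟨Iso.refl _⟩⟩⟩

theorem homotopyClosed_psi (T : ObjectProperty (ModFP C)) [T.IsClosedUnderIsomorphisms] :
    HomotopyClosed (Psi T) := by
  intro f g hf hg e
  obtain ⟨i⟩ := (homotopyEquivalent_iff f g).1 e
  exact (psi_iff g).2 ⟨hg, T.prop_of_iso i ((psi_iff f).1 hf).2⟩

theorem mono_of_psi {T : ObjectProperty (ModFP C)} {f : Arrow C} (hf : Psi T f) : Mono f.hom := by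
  obtain ⟨F, π, -, h⟩ := hf
  exact mono_of_modShortExact h

theorem IsClassicalTilting.map_psi [HasKernels C] {T : ObjectProperty (ModFP C)}
    (hT : IsClassicalTilting T) : (Psi T).map (Phi C) = T := by
  have := hT.isoClosed
  ext F
  rw [ObjectProperty.prop_map_iff]
  constructor
  · rintro ⟨f, hf, ⟨e⟩⟩
    exact T.prop_of_iso e ((psi_iff f).1 hf).2
  · intro hF
    obtain ⟨P₁, P₀, a, b, hP₁, hP₀, h⟩ := hT.pdim_le_one F hF
    obtain ⟨X₁, ⟨e₁⟩⟩ := exists_iso_representable_of_projective P₁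
    obtain ⟨X₀, ⟨e₀⟩⟩ := exists_iso_representable_of_projective P₀
    obtain ⟨f, hf⟩ := (representable C).map_surjective (e₁.hom ≫ a ≫ e₀.inv)
    have h' : ModShortExact ((representable C).map f) (e₀.hom ≫ b) := by
      rw [hf]
      rw [modShortExact_iff] at h ⊢
      obtain ⟨z, h₁, h₂, h₃⟩ := h
      refine ⟨by simp [z], fun X x hx => ?_, fun X x hx => ?_, fun X x => ?_⟩
      · rw [← cancel_mono e₁.hom, zero_comp]
        apply h₁
        rw [← cancel_mono e₀.inv, zero_comp, ← hx]
        simp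
      · obtain ⟨y, hy⟩ := h₂ X (x ≫ e₀.hom) (by rw [← hx]; simp)
        exact ⟨y ≫ e₁.inv, by simp [reassoc_of% hy]⟩
      · obtain ⟨y, rfl⟩ := h₃ X x
        exact ⟨y ≫ e₀.inv, by simp⟩
    obtain ⟨e⟩ := phi_iso_of_modShortExact (f := Arrow.mk f) _ h'
    exact ⟨Arrow.mk f, ⟨F, _, hF, h'⟩, ⟨e⟩⟩

theorem isIso_phiπ_rightFunctor [HasZeroObject C] (X : C) :
    IsIso (phiπ ((Preadditive.RightFreyd.rightFunctor C).obj X)) := by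
  obtain ⟨y, hy⟩ := phiπ_desc (f := (Preadditive.RightFreyd.rightFunctor C).obj X) (𝟙 _) (by
    rw [Category.comp_id]
    exact Functor.map_zero _ _ _)
  refine ⟨y, hy, ?_⟩
  rw [← cancel_epi (phiπ _), reassoc_of% hy, Category.comp_id]

/-- The horseshoe construction for an extension of `Φ(g)` by a representable functor. -/
theorem exists_of_modShortExact_phi [HasBinaryBiproducts C] {X : C} {g : Arrow C}
    (hg : Mono g.hom) {G : ModFP C} {a : (representable C).obj X ⟶ G} {b : G ⟶ (Phi C).obj g} (h : ModShortExact a b) :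
    ∃ s : g.left ⟶ X, Nonempty ((Phi C).obj (Arrow.mk (biprod.lift s g.hom)) ≅ G) := by
  rw [modShortExact_iff] at h
  obtain ⟨z, h₁, h₂, h₃⟩ := h
  obtain ⟨q, hq⟩ := h₃ _ (phiπ g)
  obtain ⟨t, ht⟩ := h₂ _ ((representable C).map g.hom ≫ q) (by rw [Category.assoc, hq, map_phiπ])
  obtain ⟨s, rfl⟩ := (representable C).map_surjective t
  -- The square `s` then `a` equals `g.hom` then `q`, so the minus sign makes the composite with
  -- `biprod.lift s g.hom` vanish.
  refine ⟨s, phi_iso_of_modShortExact (f := Arrow.mk (biprod.lift s g.hom))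
    ((representable C).map biprod.fst ≫ a - (representable C).map biprod.snd ≫ q) ?_⟩
  rw [modShortExact_iff]
  refine ⟨?_, fun Y x hx => ?_, fun Y x hx => ?_, fun Y x => ?_⟩
  · simp [← Functor.map_comp_assoc, ht]
  · obtain ⟨x, rfl⟩ := (representable C).map_surjective x
    rw [← Functor.map_comp, ← (representable C).map_zero, (representable C).map_injective.eq_iff]
      at hx
    have : x ≫ g.hom = 0 := by simpa using congrArg (· ≫ biprod.snd) hx
    rw [zero_of_comp_mono _ this, Functor.map_zero]
  · obtain ⟨w, rfl⟩ := (representable C).map_surjective x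
    rw [Preadditive.comp_sub, ← Functor.map_comp_assoc, ← Functor.map_comp_assoc, sub_eq_zero]
      at hx
    have hw : (representable C).map (w ≫ biprod.snd) ≫ phiπ g = 0 := by
      rw [← hq, ← reassoc_of% hx, z, comp_zero]
    obtain ⟨k, hk⟩ := (map_phiπ_eq_zero_iff _).1 hw
    refine ⟨(representable C).map k, ?_⟩
    rw [← Functor.map_comp]
    congr 1
    refine biprod.hom_ext _ _ ?_ (by simpa using hk)
    apply (representable C).map_injective
    rw [← sub_eq_zero]
    apply h₁
    have hs : (k ≫ biprod.lift s g.hom) ≫ biprod.fst = k ≫ s := by simp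
    rw [Preadditive.sub_comp, hx, ← hk]
    change (representable C).map ((k ≫ biprod.lift s g.hom) ≫ biprod.fst) ≫ a - _ = 0
    rw [hs, Functor.map_comp, Functor.map_comp, Category.assoc, Category.assoc, ht, sub_self]
  · obtain ⟨u, hu⟩ := exists_lift_phiπ (x ≫ b)
    obtain ⟨v, hv⟩ := h₂ _ (x - (representable C).map u ≫ q) (by
      rw [Preadditive.sub_comp, Category.assoc, hq, hu, sub_self])
    obtain ⟨v, rfl⟩ := (representable C).map_surjective v
    refine ⟨(representable C).map (biprod.lift v (-u)), ?_⟩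
    rw [Preadditive.comp_sub, ← Functor.map_comp_assoc, ← Functor.map_comp_assoc]
    simp [hv]

variable [HasKernels C] [HasZeroObject C] [HasBinaryBiproducts C]

theorem ClassicalConditions.isRelativeTilting {T : ObjectProperty (Arrow C)}
    [hc : T.IsClosedUnderIsomorphisms] (hT : ClassicalConditions T) : IsRelativeTilting T where
  isoClosed := hc
  finite_fPdim M hM := ⟨1, fPdimLE_one (hT.mono M hM)⟩
  fExt_eq_zero M N hM hN := fExtSuccVanishes (hT.mono M hM)
    ((fExtOneVanishes_iff (hT.mono M hM) (hT.mono N hN)).1 (hT.fExtOne_eq_zero M N hM hN))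
  coresolution X := by
    obtain ⟨T₀, T₁, T₁', f, g, i, p, hf, hg, -, hip⟩ := hT.coresolution X
    exact ⟨1, .step 0 _ _ _ i p hf hip (.base _ _ (Iso.refl _) hg)⟩

theorem ClassicalConditions.isClassicalTilting {T : ObjectProperty (Arrow C)}
    (hT : ClassicalConditions T) : IsClassicalTilting (T.map (Phi C)) where
  isoClosed := inferInstance
  pdim_le_one := by
    rintro F ⟨f, hf, ⟨e⟩⟩
    exact ⟨_, _, _, _, projective_representable f.left, projective_representable f.right,
      (modShortExact_phiπ (hT.mono f hf)).of_iso (Iso.refl _) e⟩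
  ext_eq_zero := by
    rintro F G ⟨f, hf, ⟨e⟩⟩ ⟨g, hg, ⟨e'⟩⟩ H a b hab
    have h := (fExtOneVanishes_iff (hT.mono f hf) (hT.mono g hg)).1 (hT.fExtOne_eq_zero f g hf hg)
    have : IsSplitEpi (b ≫ e.inv) := isSplitEpi_of_crossVanishing h (hab.of_iso e' e.symm)
    have hs : section_ (b ≫ e.inv) ≫ b ≫ e.inv = 𝟙 _ := IsSplitEpi.id _
    refine ⟨⟨⟨e.inv ≫ section_ (b ≫ e.inv), ?_⟩⟩⟩
    rw [← cancel_mono e.inv]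
    simp [hs]
  coresolution X := by
    obtain ⟨T₀, T₁, T₁', f, g, i, p, hf, hg, -, hip⟩ := hT.coresolution X
    have := isIso_phiπ_rightFunctor X
    exact ⟨_, _, _, _, T.prop_map_obj _ hf, T.prop_map_obj _ hg,
      (hip.columnsSplit.modShortExact (hT.mono _ hg)).of_iso (asIso (phiπ _)) (Iso.refl _)⟩

theorem IsClassicalTilting.classicalConditions {T : ObjectProperty (Arrow C)}
    (hm : ∀ f, T f → Mono f.hom) (hT : HomotopyClosed T)
    (h : IsClassicalTilting (T.map (Phi C))) : ClassicalConditions T where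
  mono := hm
  fExtOne_eq_zero f g hf hg := by
    rw [fExtOneVanishes_iff (hm f hf) (hm g hg)]
    exact crossVanishing_of_isSplitEpi (hm f hf)
      (h.ext_eq_zero _ _ (T.prop_map_obj _ hf) (T.prop_map_obj _ hg))
  coresolution X := by
    obtain ⟨G₀, G₁, a, b, ⟨f', hf', ⟨e'⟩⟩, ⟨g, hg, ⟨e⟩⟩, hab⟩ := h.coresolution X
    obtain ⟨s, ⟨j⟩⟩ := exists_of_modShortExact_phi (hm g hg) (hab.of_iso (Iso.refl _) e.symm)
    have := hm g hg
    have hmono : Mono (biprod.lift s g.hom) := by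
      have : Mono (biprod.lift s g.hom ≫ biprod.snd) := by
        rw [biprod.lift_snd]
        infer_instance
      exact mono_of_mono _ biprod.snd
    -- The horseshoe map has the same source as `g`, which gives the identity in the first column.
    -- It need not be `f'`, only homotopy equivalent to it; homotopy closedness puts it in `T`.
    refine ⟨g.left, X ⊞ g.right, g.right, biprod.lift s g.hom, g.hom,
      Arrow.homMk 0 biprod.inl ((isZero_rightFunctor_left X).eq_of_src _ _),
      Arrow.homMk (𝟙 _) biprod.snd (by simp), ?_, hg, rfl, ?_⟩
    · exact hT f' _ hf' hmono ((homotopyEquivalent_iff _ _).2 ⟨e' ≪≫ j.symm⟩)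
    · exact ColumnsSplit.fExact ⟨splitShort_id (isZero_rightFunctor_left X) _,
        splitShort_biprod _ _⟩ (mono_of_isZero_left (isZero_rightFunctor_left X)) (hm g hg)

variable (C) in
/-- The correspondence between relative tilting subcategories of `maps(C)` and classical tilting
subcategories of `mod(C)`, for an additive category `C` with kernels. -/
theorem tilting_correspondence :
    (Set.BijOn (fun 𝒯 : ObjectProperty (Arrow C) => 𝒯.map (Phi C))
        {𝒯 | HomotopyClosed 𝒯 ∧ IsRelativeTilting 𝒯 ∧ ClassicalConditions 𝒯}
        {T | IsClassicalTilting T}) ∧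
    (Set.InvOn Psi (fun 𝒯 : ObjectProperty (Arrow C) => 𝒯.map (Phi C))
        {𝒯 | HomotopyClosed 𝒯 ∧ IsRelativeTilting 𝒯 ∧ ClassicalConditions 𝒯}
        {T | IsClassicalTilting T}) ∧
    (∀ 𝒯 : ObjectProperty (Arrow C), 𝒯.IsClosedUnderIsomorphisms → ClassicalConditions 𝒯 →
      IsRelativeTilting 𝒯 ∧ IsClassicalTilting (𝒯.map (Phi C)) ∧
        ∀ g, Psi (𝒯.map (Phi C)) g ↔ Mono g.hom ∧ ∃ f, 𝒯 f ∧ HomotopyEquivalent f g) ∧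
    (∀ 𝒯 : ObjectProperty (Arrow C), (∀ f, 𝒯 f → Mono f.hom) → HomotopyClosed 𝒯 →
      ((IsRelativeTilting 𝒯 ∧ ClassicalConditions 𝒯) ↔
        IsClassicalTilting (𝒯.map (Phi C)))) := by
  have key : ∀ 𝒯 : ObjectProperty (Arrow C), (∀ f, 𝒯 f → Mono f.hom) → HomotopyClosed 𝒯 →
      ((IsRelativeTilting 𝒯 ∧ ClassicalConditions 𝒯) ↔ IsClassicalTilting (𝒯.map (Phi C))) := by
    intro 𝒯 hm hc
    have := hc.isClosedUnderIsomorphisms hm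
    exact ⟨fun h => h.2.isClassicalTilting, fun h =>
      have h' := h.classicalConditions hm hc
      ⟨h'.isRelativeTilting, h'⟩⟩
  have inv : Set.InvOn Psi (fun 𝒯 : ObjectProperty (Arrow C) => 𝒯.map (Phi C))
      {𝒯 | HomotopyClosed 𝒯 ∧ IsRelativeTilting 𝒯 ∧ ClassicalConditions 𝒯}
      {T | IsClassicalTilting T} :=
    ⟨fun _ h => h.1.psi_map h.2.2.mono, fun _ h => IsClassicalTilting.map_psi h⟩
  refine ⟨inv.bijOn (fun _ h => h.2.2.isClassicalTilting) fun T hT => ?_, inv,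
    fun 𝒯 _ h => ⟨h.isRelativeTilting, h.isClassicalTilting, psi_map_iff 𝒯⟩, key⟩
  have := hT.isoClosed
  -- Since `Φ(Ψ(T)) = T`, the equivalence `key` applied to `Ψ(T)` supplies the conditions on the
  -- maps side.
  refine ⟨homotopyClosed_psi T, (key _ (fun _ => mono_of_psi) (homotopyClosed_psi T)).2 ?_⟩
  rw [hT.map_psi]
  exact hT

end Tilting

end MapsTilting

/-- The artin hypothesis enters through left noetherianness, which provides kernels of maps between
finitely generated modules. -/
theorem mainTheorem4 {R : Type w} {Λ : Type u} [CommRing R] [IsArtinianRing R] [Ring Λ]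
    [Algebra R Λ] [Module.Finite R Λ] :
    haveI : IsNoetherianRing Λ := MapsTilting.isNoetherianRing_of_artinAlgebra R Λ
    -- `𝒯 ↦ Φ(𝒯)` and `T ↦ Ψ(T)` are mutually inverse bijections
    (Set.BijOn (fun 𝒯 : ObjectProperty (Arrow (FGModuleCat.{u} Λ)) =>
          𝒯.map (MapsTilting.Phi (FGModuleCat.{u} Λ)))
        {𝒯 | MapsTilting.HomotopyClosed 𝒯 ∧ MapsTilting.IsRelativeTilting 𝒯 ∧
          MapsTilting.ClassicalConditions 𝒯}
        {T | MapsTilting.IsClassicalTilting T}) ∧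
    (Set.InvOn MapsTilting.Psi
        (fun 𝒯 : ObjectProperty (Arrow (FGModuleCat.{u} Λ)) =>
          𝒯.map (MapsTilting.Phi (FGModuleCat.{u} Λ)))
        {𝒯 | MapsTilting.HomotopyClosed 𝒯 ∧ MapsTilting.IsRelativeTilting 𝒯 ∧
          MapsTilting.ClassicalConditions 𝒯}
        {T | MapsTilting.IsClassicalTilting T}) ∧
    -- the three conditions imply that `𝒯` is relative tilting and that `Φ(𝒯)` is classical tilting,
    -- and then `Ψ(Φ(𝒯))` is the closure of `𝒯` under homotopy equivalence of monomorphisms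
    (∀ 𝒯 : ObjectProperty (Arrow (FGModuleCat.{u} Λ)), 𝒯.IsClosedUnderIsomorphisms →
      MapsTilting.ClassicalConditions 𝒯 →
        MapsTilting.IsRelativeTilting 𝒯 ∧
        MapsTilting.IsClassicalTilting (𝒯.map (MapsTilting.Phi (FGModuleCat.{u} Λ))) ∧
        ∀ g, MapsTilting.Psi (𝒯.map (MapsTilting.Phi (FGModuleCat.{u} Λ))) g ↔
          Mono g.hom ∧ ∃ f, 𝒯 f ∧ MapsTilting.HomotopyEquivalent f g) ∧
    -- a homotopy closed class of monomorphisms satisfies the conditions as soon as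
    -- `Φ(𝒯)` is classical tilting
    (∀ 𝒯 : ObjectProperty (Arrow (FGModuleCat.{u} Λ)), (∀ f, 𝒯 f → Mono f.hom) →
      MapsTilting.HomotopyClosed 𝒯 →
        ((MapsTilting.IsRelativeTilting 𝒯 ∧ MapsTilting.ClassicalConditions 𝒯) ↔
          MapsTilting.IsClassicalTilting (𝒯.map (MapsTilting.Phi (FGModuleCat.{u} Λ))))) := by
  have : IsNoetherianRing Λ := MapsTilting.isNoetherianRing_of_artinAlgebra R Λ
  exact MapsTilting.tilting_correspondence (FGModuleCat.{u} Λ)
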